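/- **Theorem 3.1.** Let $X_1,\dots,X_n$ ($n\ge 1$) be a random sample from the Topp–Leone distribution with unknown shape parameter $\alpha\in(0,\infty)$, i.e. with pdf $f(x)=\alpha(2-2x)(2x-x^2)^{\alpha-1}$, $0<x<1$, and corresponding cdf $F(x)=(2x-x^2)^{\alpha}$, $0<x<1$. Let $T=-\sum_{i=1}^n\ln(2X_i-X_i^2)$ and fix $x\in(0,1)$. An estimator is a measurable real function of $(X_1,\dots,X_n)$; a UMVUE (uniformly minimum variance unbiased estimator) of a quantity depending on $\alpha$ is an estimator that is unbiased for it for every $\alpha>0$ and whose variance is, for every $\alpha>0$, at most that of any other unbiased estimator. Then the following hold, and in both cases the UMVUE is unique up to almost sure equality for every $\alpha>0$. (a) If $n\ge 2$, the UMVUE of $f(x)$ is the estimator whose value, given $T=t$, is $$\tilde f(x)=\frac{(n-1)(2-2x)\,(t+\ln(2x-x^2))^{n-2}}{(2x-x^2)\,t^{n-1}}\quad\text{if } t>-\ln(2x-x^2),$$ and $\tilde f(x)=0$ otherwise. (b) The UMVUE of $F(x)$ is the estimator whose value, given $T=t$, is $$\tilde F(x)=\left(\frac{t+\ln(2x-x^2)}{t}\right)^{n-1}\quad\text{if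 } t>-\ln(2x-x^2),$$ and $\tilde F(x)=0$ otherwise. -/

import Mathlib

open MeasureTheory ProbabilityTheory

noncomputable section

/-- `δ` is an unbiased estimator of `g θ` in the statistical model `(P θ)` on the sample space
`Ω`: for every parameter `θ` the expectation of `δ` under `P θ` exists and equals `g θ`. -/
structure IsUnbiasedEstimator {Θ Ω : Type*} [MeasurableSpace Ω] (P : Θ → Measure Ω)
    (g : Θ → ℝ) (δ : Ω → ℝ) : Prop where
  measurable : Measurable δ
  integrable : ∀ θ, Integrable δ (P θ)
  integral_eq : ∀ θ, ∫ ω, δ ω ∂(P θ) = g θ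

/-- `δ` is a uniformly minimum variance unbiased estimator of `g θ`: it is unbiased, and at every
parameter its variance (in `[0, ∞]`) is at most that of any unbiased estimator. -/
structure IsUMVUE {Θ Ω : Type*} [MeasurableSpace Ω] (P : Θ → Measure Ω)
    (g : Θ → ℝ) (δ : Ω → ℝ) : Prop where
  unbiased : IsUnbiasedEstimator P g δ
  evariance_le : ∀ δ' : Ω → ℝ, IsUnbiasedEstimator P g δ' →
    ∀ θ, evariance δ (P θ) ≤ evariance δ' (P θ)

/-- The density of the Topp–Leone distribution with shape parameter `α`. -/
def toppLeonePDF (α x : ℝ) : ℝ :=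
  if 0 < x ∧ x < 1 then α * (2 - 2 * x) * (2 * x - x ^ 2) ^ (α - 1) else 0

/-- The Topp–Leone distribution with shape parameter `α`. -/
def toppLeoneMeasure (α : ℝ) : Measure ℝ :=
  volume.withDensity fun x => ENNReal.ofReal (toppLeonePDF α x)

/-- The joint law of a random sample of size `n` from the Topp–Leone distribution with unknown
shape parameter `α ∈ (0, ∞)`. -/
def toppLeoneSample (n : ℕ) (α : Set.Ioi (0 : ℝ)) : Measure (Fin n → ℝ) :=
  Measure.pi fun _ => toppLeoneMeasure α

/-- The statistic `T = -∑ ln (2 Xᵢ - Xᵢ²)`. -/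
def statT {n : ℕ} (X : Fin n → ℝ) : ℝ :=
  -∑ i, Real.log (2 * X i - X i ^ 2)

/-- The claimed estimate of the density at `x`, given `T = t`. -/
def pdfEstimate (n : ℕ) (x t : ℝ) : ℝ :=
  if -Real.log (2 * x - x ^ 2) < t then
    ((n : ℝ) - 1) * (2 - 2 * x) * (t + Real.log (2 * x - x ^ 2)) ^ (n - 2) /
      ((2 * x - x ^ 2) * t ^ (n - 1))
  else 0

/-- The claimed estimate of the distribution function at `x`, given `T = t`. -/
def cdfEstimate (n : ℕ) (x t : ℝ) : ℝ :=
  if -Real.log (2 * x - x ^ 2) < t then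
    ((t + Real.log (2 * x - x ^ 2)) / t) ^ (n - 1)
  else 0

end

/-! The model is an exponential family in `T`: moving from `α` to `α + s` multiplies the joint
density by `((α + s) / α) ^ n * exp (-s T)`. Hence an unbiased estimator `U` of zero satisfies
`E_α[exp (-k T) U] = 0` for every natural `k`. Since `exp (-T)` lies in `[0, 1]`, its moments
determine measures, so `E_α[h(T) U] = 0` for every bounded measurable `h`
(`integral_comp_statT_mul_eq_zero`). By the covariance criterion
(`IsUMVUE.of_integral_mul_eq_zero`), `h(T)` is then the essentially unique UMVUE of its mean; no
conditioning on `T` is needed.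

The same tilt gives the Laplace transform of `T`, which is gamma (`map_statT_toppLeoneSample`). Both
estimates are bounded and turn the gamma density into the target quantity times a gamma density
shifted by `-log (2x - x²)`, which integrates to one. -/

/-! ### Moments, the covariance criterion, product densities -/

lemma hasSum_complexMGF_of_abs_le_one {Ω : Type*} [MeasurableSpace Ω] {μ : Measure Ω}
    [IsFiniteMeasure μ] {X : Ω → ℝ} (hX : Measurable X) (hX1 : ∀ᵐ ω ∂μ, |X ω| ≤ 1) (z : ℂ) :
    HasSum (fun k : ℕ => z ^ k / (k.factorial : ℂ) * ((∫ ω, X ω ^ k ∂μ : ℝ) : ℂ))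
      (complexMGF X μ z) := by
  have hb (k : ℕ) : ∀ᵐ ω ∂μ,
      ‖z ^ k / (k.factorial : ℂ) * ((X ω : ℂ) ^ k)‖ ≤ ‖z‖ ^ k / (k.factorial : ℝ) := by
    filter_upwards [hX1] with ω hω
    simp only [norm_mul, norm_div, norm_pow, Complex.norm_natCast, Complex.norm_real,
      Real.norm_eq_abs]
    exact mul_le_of_le_one_right (by positivity) (pow_le_one₀ (abs_nonneg _) hω)
  have hint (k : ℕ) : Integrable (fun ω => z ^ k / (k.factorial : ℂ) * ((X ω : ℂ) ^ k)) μ :=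
    Integrable.of_bound (by fun_prop) _ (hb k)
  have hs : Summable fun k : ℕ => ∫ ω, ‖z ^ k / (k.factorial : ℂ) * ((X ω : ℂ) ^ k)‖ ∂μ := by
    refine Summable.of_nonneg_of_le (fun k => integral_nonneg fun ω => norm_nonneg _)
      (fun k => ?_) ((Real.summable_pow_div_factorial ‖z‖).mul_right (μ.real Set.univ))
    calc _ ≤ ∫ _, ‖z‖ ^ k / (k.factorial : ℝ) ∂μ :=
          integral_mono_ae (hint k).norm (integrable_const _) (hb k)
      _ = _ := by rw [integral_const, smul_eq_mul, mul_comm]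
  have h1 (k : ℕ) : z ^ k / (k.factorial : ℂ) * ((∫ ω, X ω ^ k ∂μ : ℝ) : ℂ)
      = ∫ ω, z ^ k / (k.factorial : ℂ) * ((X ω : ℂ) ^ k) ∂μ := by
    rw [integral_const_mul, ← integral_complex_ofReal]
    simp
  have h2 : complexMGF X μ z
      = ∫ ω, ∑' k : ℕ, z ^ k / (k.factorial : ℂ) * ((X ω : ℂ) ^ k) ∂μ := by
    unfold complexMGF
    congr 1
    ext ω
    rw [Complex.exp_eq_exp_ℂ, NormedSpace.exp_eq_tsum_div]
    refine tsum_congr fun k => ?_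
    rw [mul_pow]; ring
  rw [h2]
  simp_rw [h1]
  exact hasSum_integral_of_summable_integral_norm hint hs

/-- The moments of random variables with values in `[-1, 1]` determine their distributions. -/
lemma MeasureTheory.Measure.ext_of_integral_pow_eq {Ω Ω' : Type*} [MeasurableSpace Ω]
    [MeasurableSpace Ω'] {μ : Measure Ω} {ν : Measure Ω'} [IsFiniteMeasure μ] [IsFiniteMeasure ν]
    {X : Ω → ℝ} {Y : Ω' → ℝ} (hX : Measurable X) (hY : Measurable Y)
    (hX1 : ∀ᵐ ω ∂μ, |X ω| ≤ 1) (hY1 : ∀ᵐ ω ∂ν, |Y ω| ≤ 1)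
    (h : ∀ k : ℕ, ∫ ω, X ω ^ k ∂μ = ∫ ω, Y ω ^ k ∂ν) :
    μ.map X = ν.map Y := by
  refine Measure.ext_of_complexMGF_eq hX.aemeasurable hY.aemeasurable (funext fun z => ?_)
  have h1 := hasSum_complexMGF_of_abs_le_one hX hX1 z
  simp_rw [h] at h1
  exact h1.unique (hasSum_complexMGF_of_abs_le_one hY hY1 z)

/-- A bounded unbiased estimator which is uncorrelated with every unbiased estimator of zero is the
essentially unique UMVUE. -/
lemma IsUMVUE.of_integral_mul_eq_zero {Θ Ω : Type*} [MeasurableSpace Ω] {P : Θ → Measure Ω}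
    [∀ θ, IsProbabilityMeasure (P θ)] {g : Θ → ℝ} {h : Ω → ℝ} (hh : IsUnbiasedEstimator P g h)
    {C : ℝ} (hC : ∀ ω, |h ω| ≤ C)
    (hU : ∀ U : Ω → ℝ, IsUnbiasedEstimator P 0 U → ∀ θ, ∫ ω, h ω * U ω ∂(P θ) = 0) :
    IsUMVUE P g h ∧ ∀ δ, IsUMVUE P g δ → ∀ θ, δ =ᵐ[P θ] h := by
  have hL (θ : Θ) : MemLp h 2 (P θ) :=
    MemLp.of_bound hh.measurable.aestronglyMeasurable C (.of_forall hC)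
  -- Pythagoras: `δ - h` is unbiased for zero, hence orthogonal to `h`. This yields both minimality
  -- and uniqueness.
  have key (δ : Ω → ℝ) (hδ : IsUnbiasedEstimator P g δ) (θ : Θ) (hδL : MemLp δ 2 (P θ)) :
      Var[δ; P θ] = Var[h; P θ] + ∫ ω, (δ ω - h ω) ^ 2 ∂(P θ) := by
    have hZ : IsUnbiasedEstimator P 0 (fun ω => δ ω - h ω) :=
      ⟨hδ.measurable.sub hh.measurable, fun θ => (hδ.integrable θ).sub (hh.integrable θ),
        fun θ => by
          rw [integral_sub (hδ.integrable θ) (hh.integrable θ), hδ.integral_eq, hh.integral_eq]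
          simp⟩
    have h0 := hU _ hZ θ
    have hd : MemLp (fun ω => δ ω - h ω) 2 (P θ) := hδL.sub (hL θ)
    have i1 := (hL θ).integrable_sq
    have i2 : Integrable (fun ω => h ω * (δ ω - h ω)) (P θ) := (hL θ).integrable_mul hd
    have i3 := hd.integrable_sq
    rw [variance_eq_sub hδL, variance_eq_sub (hL θ), hδ.integral_eq, hh.integral_eq]
    have : ∫ ω, (δ ^ 2) ω ∂(P θ) = ∫ ω, (h ω ^ 2 + 2 * (h ω * (δ ω - h ω)))
        + (δ ω - h ω) ^ 2 ∂(P θ) := by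
      congr 1; ext ω; simp only [Pi.pow_apply]; ring
    have i12 : Integrable (fun ω => h ω ^ 2 + 2 * (h ω * (δ ω - h ω))) (P θ) :=
      i1.add (i2.const_mul 2)
    rw [this, integral_add i12 i3, integral_add i1 (i2.const_mul 2),
      integral_const_mul, h0]
    simp only [Pi.pow_apply]
    ring
  refine ⟨⟨hh, fun δ hδ θ => ?_⟩, fun δ hδ θ => ?_⟩
  · by_cases hδL : MemLp δ 2 (P θ)
    · rw [← ofReal_variance hδL, ← ofReal_variance (hL θ), key δ hδ θ hδL]
      refine ENNReal.ofReal_le_ofReal ?_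
      have : 0 ≤ ∫ ω, (δ ω - h ω) ^ 2 ∂(P θ) := integral_nonneg fun ω => sq_nonneg _
      linarith
    · rw [evariance_eq_top hδ.measurable.aestronglyMeasurable hδL]
      exact le_top
  · have hle := hδ.evariance_le h hh θ
    have hδL : MemLp δ 2 (P θ) :=
      (evariance_lt_top_iff_memLp hδ.unbiased.measurable.aestronglyMeasurable).1
        (hle.trans_lt (evariance_lt_top (hL θ)))
    rw [← ofReal_variance hδL, ← ofReal_variance (hL θ), key δ hδ.unbiased θ hδL,
      ENNReal.ofReal_le_ofReal_iff (variance_nonneg _ _)] at hle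
    have hn : 0 ≤ ∫ ω, (δ ω - h ω) ^ 2 ∂(P θ) := integral_nonneg fun ω => sq_nonneg _
    have h0 : ∫ ω, (δ ω - h ω) ^ 2 ∂(P θ) = 0 := by linarith
    have hi : Integrable (fun ω => (δ ω - h ω) ^ 2) (P θ) := (hδL.sub (hL θ)).integrable_sq
    rw [integral_eq_zero_iff_of_nonneg (fun ω => sq_nonneg _) hi] at h0
    filter_upwards [h0] with ω hω
    simpa [sub_eq_zero] using hω

lemma MeasureTheory.Measure.pi_withDensity {ι : Type*} [Fintype ι] {E : Type*} [MeasurableSpace E]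
    (μ : Measure E) [IsProbabilityMeasure μ] {f : E → ENNReal} (hf : Measurable f)
    [SigmaFinite (μ.withDensity f)] :
    Measure.pi (fun _ : ι => μ.withDensity f)
      = (Measure.pi fun _ : ι => μ).withDensity fun x => ∏ i, f (x i) := by
  refine Measure.pi_eq fun s hs => ?_
  have hg (i : ι) : Measurable ((s i).indicator f) := hf.indicator (hs i)
  rw [withDensity_apply _ (MeasurableSet.univ_pi hs),
    ← lintegral_indicator (MeasurableSet.univ_pi hs)]
  have h1 : ((Set.univ.pi s).indicator fun x : ι → E => ∏ i, f (x i))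
      = fun x => ∏ i, (s i).indicator f (x i) := by
    ext x
    by_cases hx : x ∈ Set.univ.pi s
    · rw [Set.indicator_of_mem hx]
      exact Finset.prod_congr rfl fun i _ => (Set.indicator_of_mem (hx i trivial) f).symm
    · rw [Set.indicator_of_notMem hx]
      simp only [Set.mem_pi, Set.mem_univ, true_imp_iff, not_forall] at hx
      obtain ⟨i, hi⟩ := hx
      exact (Finset.prod_eq_zero (Finset.mem_univ i) (Set.indicator_of_notMem hi f)).symm
  have hind := iIndepFun_pi (μ := fun _ : ι => μ) (X := fun i => (s i).indicator f)
    fun i => (hg i).aemeasurable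
  rw [h1, lintegral_prod_eq_prod_lintegral_of_indepFun Finset.univ _ hind
    fun i => (hg i).comp (measurable_pi_apply i)]
  refine Finset.prod_congr rfl fun i _ => ?_
  rw [withDensity_apply _ (hs i), ← lintegral_indicator (hs i)]
  exact (measurePreserving_eval (fun _ : ι => μ) i).lintegral_comp (hg i)

/-! ### The Topp–Leone distribution -/

lemma two_mul_sub_sq_pos {x : ℝ} (hx : 0 < x ∧ x < 1) : 0 < 2 * x - x ^ 2 := by
  nlinarith [hx.1, hx.2]

lemma two_mul_sub_sq_lt_one {x : ℝ} (hx : 0 < x ∧ x < 1) : 2 * x - x ^ 2 < 1 := by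
  nlinarith [hx.1, hx.2]

lemma toppLeonePDF_nonneg {α : ℝ} (hα : 0 < α) (x : ℝ) : 0 ≤ toppLeonePDF α x := by
  unfold toppLeonePDF
  split_ifs with h
  · have := two_mul_sub_sq_pos h
    have : 0 < 2 - 2 * x := by linarith [h.2]
    positivity
  · exact le_rfl

@[fun_prop]
lemma measurable_toppLeonePDF (α : ℝ) : Measurable (toppLeonePDF α) := by
  unfold toppLeonePDF
  exact Measurable.ite (measurableSet_Ioi.inter measurableSet_Iio) (by fun_prop) (by fun_prop)

lemma toppLeoneMeasure_Iic {α : ℝ} (hα : 0 < α) {x : ℝ} (hx0 : 0 ≤ x) (hx1 : x ≤ 1) :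
    toppLeoneMeasure α (Set.Iic x) = ENNReal.ofReal ((2 * x - x ^ 2) ^ α) := by
  have hcont : ContinuousOn (fun y : ℝ => (2 * y - y ^ 2) ^ α) (Set.Icc 0 x) :=
    ((by fun_prop : Continuous fun y : ℝ => 2 * y - y ^ 2).rpow_const
      fun _ => Or.inr hα.le).continuousOn
  have hIoo {y : ℝ} (hy : y ∈ Set.Ioo 0 x) : 0 < y ∧ y < 1 := ⟨hy.1, hy.2.trans_le hx1⟩
  have hderiv : ∀ y ∈ Set.Ioo 0 x,
      HasDerivAt (fun y : ℝ => (2 * y - y ^ 2) ^ α) (toppLeonePDF α y) y := by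
    intro y hy
    have h1 : HasDerivAt (fun y : ℝ => 2 * y - y ^ 2) (2 - 2 * y) y := by
      simpa using ((hasDerivAt_id' y).const_mul 2).fun_sub ((hasDerivAt_id' y).fun_pow 2)
    convert h1.rpow_const (p := α) (Or.inl (two_mul_sub_sq_pos (hIoo hy)).ne') using 1
    rw [toppLeonePDF, if_pos (hIoo hy)]
    ring
  -- For `α < 1` the density is unbounded near `0`; integrability comes from its being the
  -- nonnegative derivative of a continuous function.
  have hint : IntegrableOn (toppLeonePDF α) (Set.Ioc 0 x) :=
    intervalIntegral.integrableOn_deriv_of_nonneg hcont hderiv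
      fun y _ => toppLeonePDF_nonneg hα y
  have hftc := intervalIntegral.integral_eq_sub_of_hasDerivAt_of_le hx0 hcont hderiv
    ((intervalIntegrable_iff_integrableOn_Ioc_of_le hx0).2 hint)
  rw [intervalIntegral.integral_of_le hx0] at hftc
  have hz : ∫⁻ y in Set.Iic 0, ENNReal.ofReal (toppLeonePDF α y) = 0 := by
    rw [setLIntegral_congr_fun (g := fun _ => 0) measurableSet_Iic, lintegral_zero]
    intro y hy
    simp [toppLeonePDF, not_lt.2 (Set.mem_Iic.1 hy)]
  rw [toppLeoneMeasure, withDensity_apply _ measurableSet_Iic, ← Set.Iic_union_Ioc_eq_Iic hx0,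
    lintegral_union measurableSet_Ioc (Set.Iic_disjoint_Ioc le_rfl), hz, zero_add,
    ← ofReal_integral_eq_lintegral_ofReal hint (.of_forall (toppLeonePDF_nonneg hα)), hftc]
  simp [Real.zero_rpow hα.ne']

lemma ae_toppLeoneMeasure (α : ℝ) : ∀ᵐ x ∂(toppLeoneMeasure α), 0 < x ∧ x < 1 := by
  rw [toppLeoneMeasure, ae_withDensity_iff (by fun_prop)]
  refine .of_forall fun x hx => ?_
  by_contra h
  simp [toppLeonePDF, h] at hx

lemma isProbabilityMeasure_toppLeoneMeasure {α : ℝ} (hα : 0 < α) :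
    IsProbabilityMeasure (toppLeoneMeasure α) := by
  constructor
  have h : toppLeoneMeasure α Set.univ = toppLeoneMeasure α (Set.Iic 1) := by
    refine measure_congr ?_
    filter_upwards [ae_toppLeoneMeasure α] with x hx
    exact propext ⟨fun _ => hx.2.le, fun _ => trivial⟩
  rw [h, toppLeoneMeasure_Iic hα zero_le_one le_rfl]
  norm_num

instance (n : ℕ) (α : Set.Ioi (0 : ℝ)) : IsProbabilityMeasure (toppLeoneSample n α) := by
  have := isProbabilityMeasure_toppLeoneMeasure α.2
  unfold toppLeoneSample
  infer_instance

lemma cdf_toppLeoneMeasure {α : ℝ} (hα : 0 < α) {x : ℝ} (hx : 0 < x ∧ x < 1) :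
    cdf (toppLeoneMeasure α) x = (2 * x - x ^ 2) ^ α := by
  have := isProbabilityMeasure_toppLeoneMeasure hα
  rw [cdf_eq_real, measureReal_def, toppLeoneMeasure_Iic hα hx.1.le hx.2.le,
    ENNReal.toReal_ofReal (Real.rpow_nonneg (two_mul_sub_sq_pos hx).le α)]

lemma toppLeoneMeasure_add {α s : ℝ} (hα : 0 < α) :
    toppLeoneMeasure (α + s) = (toppLeoneMeasure α).withDensity fun x =>
      ENNReal.ofReal ((α + s) / α * Real.exp (s * Real.log (2 * x - x ^ 2))) := by
  rw [toppLeoneMeasure, toppLeoneMeasure, ← withDensity_mul _ (by fun_prop) (by fun_prop)]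
  congr 1
  ext x
  rw [Pi.mul_apply, ← ENNReal.ofReal_mul (toppLeonePDF_nonneg hα x)]
  congr 1
  unfold toppLeonePDF
  split_ifs with h
  · have hc := two_mul_sub_sq_pos h
    rw [mul_comm s, ← Real.rpow_def_of_pos hc, show α + s - 1 = (α - 1) + s by ring,
      Real.rpow_add hc]
    field_simp
  · simp

/-! ### The statistic `T` and its gamma law -/

@[fun_prop]
lemma measurable_statT {n : ℕ} : Measurable (statT : (Fin n → ℝ) → ℝ) := by
  unfold statT
  fun_prop

lemma statT_nonneg_ae (n : ℕ) (α : Set.Ioi (0 : ℝ)) :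
    ∀ᵐ X ∂(toppLeoneSample n α), 0 ≤ statT X := by
  have := isProbabilityMeasure_toppLeoneMeasure α.2
  have h : ∀ᵐ X ∂(toppLeoneSample n α), ∀ i, 0 < X i ∧ X i < 1 := by
    refine ae_all_iff.2 fun i => ?_
    exact (Measure.quasiMeasurePreserving_eval (fun _ : Fin n => toppLeoneMeasure α) i).ae
      (ae_toppLeoneMeasure α)
  filter_upwards [h] with X hX
  refine neg_nonneg.2 (Finset.sum_nonpos fun i _ => ?_)
  exact Real.log_nonpos (two_mul_sub_sq_pos (hX i)).le (two_mul_sub_sq_lt_one (hX i)).le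

/-- The exponential family structure of the sample, with sufficient statistic `statT`. -/
lemma integral_toppLeoneSample_add {n : ℕ} (α : Set.Ioi (0 : ℝ)) {s : ℝ} (hs : 0 ≤ s)
    (F : (Fin n → ℝ) → ℝ) :
    ∫ X, F X ∂(toppLeoneSample n ⟨α + s, add_pos_of_pos_of_nonneg α.2 hs⟩)
      = ((α + s) / α) ^ n * ∫ X, Real.exp (-(s * statT X)) * F X ∂(toppLeoneSample n α) := by
  have hα : 0 < (α : ℝ) := α.2
  have hs' : 0 < (α : ℝ) + s := add_pos_of_pos_of_nonneg α.2 hs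
  have := isProbabilityMeasure_toppLeoneMeasure hα
  have h2 := isProbabilityMeasure_toppLeoneMeasure hs'
  -- In this form `h2` supplies the σ-finiteness required by `Measure.pi_withDensity`.
  rw [toppLeoneMeasure_add hα] at h2
  unfold toppLeoneSample
  rw [toppLeoneMeasure_add hα, Measure.pi_withDensity _ (by fun_prop),
    integral_withDensity_eq_integral_toReal_smul (by fun_prop)
      (.of_forall fun X => ENNReal.prod_lt_top fun i _ => ENNReal.ofReal_lt_top),
    ← integral_const_mul]
  congr 1
  ext X
  rw [← ENNReal.ofReal_prod_of_nonneg fun i _ => by positivity,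
    ENNReal.toReal_ofReal (Finset.prod_nonneg fun i _ => by positivity), Finset.prod_mul_distrib,
    ← Real.exp_sum, Finset.prod_const, Finset.card_univ, Fintype.card_fin, ← Finset.mul_sum,
    smul_eq_mul, mul_assoc, statT]
  simp

/-- The total mass at `α + s`, read at `α`, gives the Laplace transform of `T`. -/
lemma integral_exp_neg_statT {n : ℕ} (α : Set.Ioi (0 : ℝ)) {s : ℝ} (hs : 0 ≤ s) :
    ((α + s) / α) ^ n * ∫ X : Fin n → ℝ, Real.exp (-(s * statT X)) ∂(toppLeoneSample n α) = 1 := by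
  simpa using (integral_toppLeoneSample_add (n := n) α hs fun _ => 1).symm

lemma measurable_gammaPDF (a r : ℝ) : Measurable (gammaPDF a r) :=
  (measurable_gammaPDFReal a r).ennreal_ofReal

lemma integral_exp_neg_gammaMeasure {a r s : ℝ} (ha : 0 < a) (hr : 0 < r) (hs : 0 ≤ s) :
    ((r + s) / r) ^ a * ∫ t, Real.exp (-(s * t)) ∂(gammaMeasure a r) = 1 := by
  have hrs : 0 < r + s := by linarith
  have := isProbabilityMeasure_gammaMeasure ha hrs
  have h1 : ∫ t, (1 : ℝ) ∂(gammaMeasure a (r + s)) = 1 := by simp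
  unfold gammaMeasure at h1 ⊢
  rw [integral_withDensity_eq_integral_toReal_smul (measurable_gammaPDF _ _)
    (.of_forall fun t => ENNReal.ofReal_lt_top)] at h1 ⊢
  rw [← h1, ← integral_const_mul]
  congr 1
  ext t
  rw [gammaPDF, gammaPDF, ENNReal.toReal_ofReal (gammaPDFReal_nonneg ha hr t),
    ENNReal.toReal_ofReal (gammaPDFReal_nonneg ha hrs t)]
  unfold gammaPDFReal
  split_ifs
  · rw [Real.div_rpow hrs.le hr.le, show -((r + s) * t) = -(r * t) + -(s * t) by ring,
      Real.exp_add]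
    have := (Real.rpow_pos_of_pos hr a).ne'
    simp only [smul_eq_mul]
    field_simp
  · simp

lemma nonneg_ae_gammaMeasure (a r : ℝ) : ∀ᵐ t ∂(gammaMeasure a r), 0 ≤ t := by
  rw [gammaMeasure, ae_withDensity_iff (measurable_gammaPDF a r)]
  refine .of_forall fun t ht => ?_
  by_contra h
  exact ht (gammaPDF_of_neg (not_le.1 h))

/-- The statistic `statT` has a gamma distribution. -/
lemma map_statT_toppLeoneSample {n : ℕ} (hn : 1 ≤ n) (α : Set.Ioi (0 : ℝ)) :
    (toppLeoneSample n α).map statT = gammaMeasure n α := by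
  have hα : 0 < (α : ℝ) := α.2
  have hn' : (0 : ℝ) < n := by exact_mod_cast hn
  have := isProbabilityMeasure_gammaMeasure hn' hα
  have h : (toppLeoneSample n α).map (fun X => Real.exp (-statT X))
      = (gammaMeasure n α).map fun t => Real.exp (-t) := by
    refine Measure.ext_of_integral_pow_eq (by fun_prop) (by fun_prop) ?_ ?_ fun k => ?_
    · filter_upwards [statT_nonneg_ae n α] with X hX
      simpa [abs_of_pos (Real.exp_pos _)] using hX
    · filter_upwards [nonneg_ae_gammaMeasure n α] with t ht
      simpa [abs_of_pos (Real.exp_pos _)] using ht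
    · have h1 := integral_exp_neg_statT (n := n) α k.cast_nonneg
      have h2 := integral_exp_neg_gammaMeasure hn' hα k.cast_nonneg
      rw [Real.rpow_natCast] at h2
      have h0 : (((α : ℝ) + k) / α) ^ n ≠ 0 := by positivity
      simp_rw [← Real.exp_nat_mul, mul_neg]
      exact mul_left_cancel₀ h0 (h1.trans h2.symm)
  have h' := congrArg (Measure.map fun y => -Real.log y) h
  rw [Measure.map_map (by fun_prop) (by fun_prop), Measure.map_map (by fun_prop) (by fun_prop)]
    at h'
  simpa [Function.comp_def] using h'

/-! ### Completeness and the resulting UMVUE criterion -/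

/-- Completeness of `statT`, in the form that bounded functions of `statT` are uncorrelated with
the unbiased estimators of zero. -/
lemma integral_comp_statT_mul_eq_zero {n : ℕ} {h : ℝ → ℝ} (hm : Measurable h) {C : ℝ}
    (hC : ∀ t, |h t| ≤ C) {U : (Fin n → ℝ) → ℝ}
    (hU : IsUnbiasedEstimator (toppLeoneSample n) 0 U) (α : Set.Ioi (0 : ℝ)) :
    ∫ X, h (statT X) * U X ∂(toppLeoneSample n α) = 0 := by
  have hα : 0 < (α : ℝ) := α.2
  have hUm := hU.measurable
  have hUi := hU.integrable α
  set P := toppLeoneSample n α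
  set μ := P.withDensity fun X => ENNReal.ofReal (U X)
  set ν := P.withDensity fun X => ENNReal.ofReal (-U X)
  have : IsFiniteMeasure μ := isFiniteMeasure_withDensity_ofReal hUi.2
  have : IsFiniteMeasure ν := isFiniteMeasure_withDensity_ofReal hUi.neg.2
  have hμ (g : (Fin n → ℝ) → ℝ) : ∫ X, g X ∂μ = ∫ X, max (U X) 0 * g X ∂P := by
    rw [integral_withDensity_eq_integral_toReal_smul (by fun_prop)
      (.of_forall fun _ => ENNReal.ofReal_lt_top)]
    simp [ENNReal.toReal_ofReal']
  have hν (g : (Fin n → ℝ) → ℝ) : ∫ X, g X ∂ν = ∫ X, max (-U X) 0 * g X ∂P := by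
    rw [integral_withDensity_eq_integral_toReal_smul (by fun_prop)
      (.of_forall fun _ => ENNReal.ofReal_lt_top)]
    simp [ENNReal.toReal_ofReal']
  have hdiff {g : (Fin n → ℝ) → ℝ} (hg : Measurable g) {C : ℝ} (hgC : ∀ᵐ X ∂P, ‖g X‖ ≤ C) :
      ∫ X, g X ∂μ - ∫ X, g X ∂ν = ∫ X, g X * U X ∂P := by
    have hUn : Integrable (fun X => -U X) P := hUi.neg
    rw [hμ, hν, ← integral_sub (hUi.pos_part.mul_bdd hg.aestronglyMeasurable hgC)
      (hUn.pos_part.mul_bdd hg.aestronglyMeasurable hgC)]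
    congr 1
    ext X
    rw [← sub_mul, mul_comm]
    congr 1
    rcases le_total (U X) 0 with h | h
    · simp [h]
    · simp [h]
  have hE : ∀ᵐ X ∂P, |Real.exp (-statT X)| ≤ 1 := by
    filter_upwards [statT_nonneg_ae n α] with X hX
    simpa [abs_of_pos (Real.exp_pos _)] using hX
  -- The `k`-th moments differ by `E_α[exp (-k T) U]`, a multiple of `E_{α+k}[U] = 0`.
  have hmap : μ.map (fun X => Real.exp (-statT X)) = ν.map fun X => Real.exp (-statT X) := by
    refine Measure.ext_of_integral_pow_eq (by fun_prop) (by fun_prop)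
      ((withDensity_absolutelyContinuous _ _).ae_le hE)
      ((withDensity_absolutelyContinuous _ _).ae_le hE) fun k => ?_
    rw [← sub_eq_zero, hdiff (C := 1) (by fun_prop)]
    · have h1 := integral_toppLeoneSample_add (n := n) α k.cast_nonneg U
      rw [hU.integral_eq] at h1
      have h0 : (((α : ℝ) + k) / α) ^ n ≠ 0 := by positivity
      simp_rw [← Real.exp_nat_mul, mul_neg]
      exact (mul_eq_zero.1 h1.symm).resolve_left h0
    · filter_upwards [hE] with X hX
      rw [norm_pow]
      exact pow_le_one₀ (norm_nonneg _) hX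
  have hg : Measurable fun y => h (-Real.log y) := by fun_prop
  have hfin := congrArg (fun m => ∫ y, h (-Real.log y) ∂m) hmap
  rw [integral_map (by fun_prop) hg.aestronglyMeasurable,
    integral_map (by fun_prop) hg.aestronglyMeasurable] at hfin
  simp only [Real.log_exp, neg_neg] at hfin
  rw [← hdiff (g := fun X => h (statT X)) (hm.comp measurable_statT)
    (.of_forall fun X => hC (statT X)), hfin, sub_self]

lemma integral_gammaPDFReal {a r : ℝ} (ha : 0 < a) (hr : 0 < r) :
    ∫ t, gammaPDFReal a r t = 1 := by
  rw [integral_eq_lintegral_of_nonneg_ae (.of_forall (gammaPDFReal_nonneg ha hr)) (by fun_prop)]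
  have := lintegral_gammaPDF_eq_one ha hr
  simp only [gammaPDF] at this
  simp [this]

/-- A bounded function of `statT` which turns the gamma density into a shifted gamma density is
the essentially unique UMVUE of its expectation. -/
lemma isUMVUE_comp_statT {n : ℕ} (hn : 1 ≤ n) {h : ℝ → ℝ} (hm : Measurable h) {C : ℝ}
    (hC : ∀ t, |h t| ≤ C) {g : Set.Ioi (0 : ℝ) → ℝ} {a m : ℝ} (hm0 : 0 < m)
    (hg : ∀ (α : Set.Ioi (0 : ℝ)) (t : ℝ), t ≠ a →
      gammaPDFReal n α t * h t = g α * gammaPDFReal m α (t - a)) :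
    IsUMVUE (toppLeoneSample n) g (fun X => h (statT X)) ∧
      ∀ δ, IsUMVUE (toppLeoneSample n) g δ →
        ∀ α, δ =ᵐ[toppLeoneSample n α] fun X => h (statT X) := by
  have hhm : Measurable fun X : Fin n → ℝ => h (statT X) := hm.comp measurable_statT
  refine IsUMVUE.of_integral_mul_eq_zero ⟨hhm, fun α => ?_, fun α => ?_⟩ (fun X => hC (statT X))
    fun U hU α => integral_comp_statT_mul_eq_zero hm hC hU α
  · exact Integrable.of_bound hhm.aestronglyMeasurable C (.of_forall fun X => hC (statT X))
  · have hα : 0 < (α : ℝ) := α.2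
    have hn' : (0 : ℝ) < n := by exact_mod_cast hn
    rw [← integral_map (φ := statT) (by fun_prop) hm.aestronglyMeasurable,
      map_statT_toppLeoneSample hn, gammaMeasure, integral_withDensity_eq_integral_toReal_smul
        (measurable_gammaPDF _ _) (.of_forall fun _ => ENNReal.ofReal_lt_top)]
    have h1 : ∀ᵐ t : ℝ, (gammaPDF n α t).toReal • h t = g α * gammaPDFReal m α (t - a) := by
      filter_upwards [Measure.ae_ne volume a] with t ht
      rw [gammaPDF, ENNReal.toReal_ofReal (gammaPDFReal_nonneg hn' hα t), smul_eq_mul, hg α t ht]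
    rw [integral_congr_ae h1, integral_const_mul,
      integral_sub_right_eq_self (fun t => gammaPDFReal m α t), integral_gammaPDFReal hm0 hα,
      mul_one]


/-! ### The two explicit estimates -/

/-- The estimate replaces `t ^ (n - 1)` by its shift, and shifting the exponential costs `(2x - x²)
^ α`. The endpoint is excluded because for `n = 1` the gamma density is nonzero at `0` while the
estimate vanishes there. -/
lemma gammaPDFReal_mul_cdfEstimate {n : ℕ} (hn : 1 ≤ n) {x : ℝ} (hx : 0 < x ∧ x < 1)
    {α : ℝ} {t : ℝ} (ht : t ≠ -Real.log (2 * x - x ^ 2)) :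
    gammaPDFReal n α t * cdfEstimate n x t
      = (2 * x - x ^ 2) ^ α * gammaPDFReal n α (t - -Real.log (2 * x - x ^ 2)) := by
  have hc := two_mul_sub_sq_pos hx
  have hL := Real.log_neg hc (two_mul_sub_sq_lt_one hx)
  obtain ⟨k, rfl⟩ := Nat.exists_eq_add_of_le' hn
  rw [Real.rpow_def_of_pos hc]
  unfold gammaPDFReal cdfEstimate
  generalize Real.log (2 * x - x ^ 2) = L at *
  rcases lt_or_gt_of_ne ht with h | h
  · rw [if_neg (not_lt.2 h.le), if_neg (by linarith : ¬ 0 ≤ t - -L)]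
    simp
  · have h0 : 0 < t := by linarith
    rw [if_pos h, if_pos h0.le, if_pos (by linarith : 0 ≤ t - -L), Nat.cast_add, Nat.cast_one,
      add_sub_cancel_right, Real.rpow_natCast, Real.rpow_natCast, Nat.add_sub_cancel, div_pow,
      show -(α * t) = L * α + -(α * (t - -L)) by ring, Real.exp_add, sub_neg_eq_add]
    field_simp

/-- The shape drops by one: the factor `n - 1` is absorbed by `Γ(n) = (n - 1) Γ(n - 1)`, and the
spare `α` enters the Topp–Leone density. -/
lemma gammaPDFReal_mul_pdfEstimate {n : ℕ} (hn : 2 ≤ n) {x : ℝ} (hx : 0 < x ∧ x < 1)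
    {α t : ℝ} (ht : t ≠ -Real.log (2 * x - x ^ 2)) :
    gammaPDFReal n α t * pdfEstimate n x t
      = toppLeonePDF α x * gammaPDFReal (n - 1) α (t - -Real.log (2 * x - x ^ 2)) := by
  have hc := two_mul_sub_sq_pos hx
  have hL := Real.log_neg hc (two_mul_sub_sq_lt_one hx)
  obtain ⟨k, rfl⟩ := Nat.exists_eq_add_of_le' hn
  rw [toppLeonePDF, if_pos hx, Real.rpow_sub_one hc.ne', Real.rpow_def_of_pos hc]
  unfold gammaPDFReal pdfEstimate
  generalize Real.log (2 * x - x ^ 2) = L at *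
  rcases lt_or_gt_of_ne ht with h | h
  · rw [if_neg (not_lt.2 h.le), if_neg (by linarith : ¬ 0 ≤ t - -L)]
    simp
  · have h0 : 0 < t := by linarith
    have hk : (0 : ℝ) < k + 1 := by positivity
    have hΓ := (Real.Gamma_pos_of_pos hk).ne'
    have e1 : ((k + 2 : ℕ) : ℝ) - 1 = k + 1 := by push_cast; ring
    have e2 : Real.Gamma ((k + 2 : ℕ) : ℝ) = (k + 1) * Real.Gamma (k + 1) := by
      rw [← Real.Gamma_add_one hk.ne']; congr 1; push_cast; ring
    rw [if_pos h, if_pos h0.le, if_pos (by linarith : 0 ≤ t - -L), e1, e2,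
      add_sub_cancel_right, Real.rpow_natCast, Real.rpow_natCast, Nat.add_sub_cancel,
      show k + 2 - 1 = k + 1 from rfl, ← Nat.cast_succ, Real.rpow_natCast, Real.rpow_natCast,
      show -(α * t) = L * α + -(α * (t - -L)) by ring, Real.exp_add, sub_neg_eq_add]
    simp only [Nat.succ_eq_add_one, Nat.cast_add, Nat.cast_one]
    field_simp
    ring

lemma abs_cdfEstimate_le (n : ℕ) {x : ℝ} (hx : 0 < x ∧ x < 1) (t : ℝ) :
    |cdfEstimate n x t| ≤ 1 := by
  have hL := Real.log_neg (two_mul_sub_sq_pos hx) (two_mul_sub_sq_lt_one hx)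
  unfold cdfEstimate
  split_ifs with h
  · have h0 : 0 < t := by linarith
    have h1 : 0 ≤ (t + Real.log (2 * x - x ^ 2)) / t := div_nonneg (by linarith) h0.le
    rw [abs_of_nonneg (pow_nonneg h1 _)]
    exact pow_le_one₀ h1 ((div_le_one h0).2 (by linarith))
  · simp

lemma abs_pdfEstimate_le {n : ℕ} (hn : 2 ≤ n) {x : ℝ} (hx : 0 < x ∧ x < 1) (t : ℝ) :
    |pdfEstimate n x t|
      ≤ ((n : ℝ) - 1) * (2 - 2 * x) / ((2 * x - x ^ 2) * -Real.log (2 * x - x ^ 2)) := by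
  have hc := two_mul_sub_sq_pos hx
  have hL := Real.log_neg hc (two_mul_sub_sq_lt_one hx)
  have hn1 : (0 : ℝ) < (n : ℝ) - 1 := by
    have : (2 : ℝ) ≤ n := by exact_mod_cast hn
    linarith
  have hx2 : 0 < 2 - 2 * x := by linarith [hx.2]
  unfold pdfEstimate
  split_ifs with h
  · obtain ⟨k, rfl⟩ := Nat.exists_eq_add_of_le' hn
    generalize Real.log (2 * x - x ^ 2) = L at *
    have h0 : 0 < t := by linarith
    have h1 : 0 < t + L := by linarith
    have h2 : 0 < -L := by linarith
    rw [abs_of_nonneg (by positivity), Nat.add_sub_cancel, show k + 2 - 1 = k + 1 from rfl,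
      div_le_div_iff₀ (by positivity) (by positivity), pow_succ]
    have h3 : (t + L) ^ k ≤ t ^ k := pow_le_pow_left₀ h1.le (by linarith) k
    -- The bound uses `t > -L > 0`: the truncation keeps `t` away from the pole at `0`.
    have h4 : (t + L) ^ k * -L ≤ t ^ k * t := mul_le_mul h3 h.le h2.le (by positivity)
    calc _ = (((k + 2 : ℕ) : ℝ) - 1) * (2 - 2 * x) * (2 * x - x ^ 2) * ((t + L) ^ k * -L) := by
          ring
      _ ≤ (((k + 2 : ℕ) : ℝ) - 1) * (2 - 2 * x) * (2 * x - x ^ 2) * (t ^ k * t) := by gcongr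
      _ = _ := by ring
  · have : 0 < -Real.log (2 * x - x ^ 2) := by linarith
    rw [abs_zero]
    positivity

@[fun_prop]
lemma measurable_cdfEstimate (n : ℕ) (x : ℝ) : Measurable (cdfEstimate n x) :=
  Measurable.ite measurableSet_Ioi (by fun_prop) measurable_const

@[fun_prop]
lemma measurable_pdfEstimate (n : ℕ) (x : ℝ) : Measurable (pdfEstimate n x) :=
  Measurable.ite measurableSet_Ioi (by fun_prop) measurable_const

theorem theorem3p1 (n : ℕ) (hn : 1 ≤ n) (x : ℝ) (hx0 : 0 < x) (hx1 : x < 1) :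
    -- the density (for sample size at least two)
    (2 ≤ n →
      IsUMVUE (toppLeoneSample n) (fun α => toppLeonePDF α x)
        (fun X => pdfEstimate n x (statT X)) ∧
      ∀ δ : (Fin n → ℝ) → ℝ,
        IsUMVUE (toppLeoneSample n) (fun α => toppLeonePDF α x) δ →
        ∀ α, δ =ᵐ[toppLeoneSample n α] fun X => pdfEstimate n x (statT X)) ∧
    -- the distribution function
    (IsUMVUE (toppLeoneSample n) (fun α => cdf (toppLeoneMeasure α) x)
        (fun X => cdfEstimate n x (statT X)) ∧
      ∀ δ : (Fin n → ℝ) → ℝ,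
        IsUMVUE (toppLeoneSample n) (fun α => cdf (toppLeoneMeasure α) x) δ →
        ∀ α, δ =ᵐ[toppLeoneSample n α] fun X => cdfEstimate n x (statT X)) := by
  have hx : 0 < x ∧ x < 1 := ⟨hx0, hx1⟩
  refine ⟨fun hn2 => ?_, ?_⟩
  · have hm : (0 : ℝ) < (n : ℝ) - 1 := by
      have : (2 : ℝ) ≤ n := by exact_mod_cast hn2
      linarith
    exact isUMVUE_comp_statT hn (by fun_prop) (abs_pdfEstimate_le hn2 hx) hm
      fun α t ht => gammaPDFReal_mul_pdfEstimate hn2 hx ht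
  · have hm : (0 : ℝ) < n := by exact_mod_cast hn
    refine isUMVUE_comp_statT hn (by fun_prop) (abs_cdfEstimate_le n hx)
      (a := -Real.log (2 * x - x ^ 2)) hm fun α t ht => ?_
    rw [cdf_toppLeoneMeasure α.2 hx]
    exact gammaPDFReal_mul_cdfEstimate hn hx ht
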